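/- \textbf{Theorem 7 (Maximum depth).} Let $b\ge 2$ and let $\mathbb T_b$ be the infinite tree with a root of degree $1$ in which every non-root vertex $v$ has a parent $v^{(0)}$ and exactly $b$ children $v^{(1)},\dots,v^{(b)}$. A rotor configuration assigns to each non-root vertex $v$ a number $r(v)\in\{0,1,\dots,b\}$, meaning that the rotor at $v$ points to $v^{(r(v))}$. At each step of the rotor walk, if the particle is at a non-root vertex $v$, then the rotor at $v$ is first incremented, cyclically in the order $v^{(0)},v^{(1)},\dots,v^{(b)}$, and then the particle moves to the neighbour to which the rotor now points; from the root the particle moves to the root's only child. Particles are started at the root one after the other. Each one performs a rotor walk, stopped at its first return to the root if there is one (otherwise it escapes to infinity, visiting every vertex only finitely many times), and the next particle starts with the rotor positions left by the previous one. Let $D_n\in\{0,1,2,\dots\}\cup\{\infty\}$ be the maximum (supremum) distance from the root reached by the first $n$ particles. Let the initial configuration $R=(R(v))_{v}$ consist of independent identically distributed random variables with values in $\{0,1,\dots,b\}$ whose common distribution is not concentrated at a single point. Then there are constants $c,C\in(0,\infty)$, depending only on $b$ and the distribution of $R(v)$, such that \begin{itemize} \item[(i)] if $\mathbb E R(v)=b-1$,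 then $\mathbb P\bigl[e^{e^{cn}}<D_n<e^{e^{Cn}}\bigr]\to1$ as $n\to\infty$; \item[(ii)] if $\mathbb E R(v)>b-1$, then $\mathbb P\bigl[n\le D_n<Cn\bigr]\to1$ as $n\to\infty$. \end{itemize} -/

import Mathlib

open Filter Topology MeasureTheory ProbabilityTheory

noncomputable section

namespace RotorWalk

/-- Vertices of the infinite `b`-ary tree whose root has degree one. The root is `none`. A non-root
vertex is `some w`, where the word `w` lists the child labels on the way to it, most recent first:
`some []` is the only child of the root, and `some (k :: w)` is a child of `some w`. -/
abbrev Vertex (b : ℕ) : Type := Option (List (Fin b))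

variable {b : ℕ}

/-- The parent of a non-root vertex. -/
def parent : List (Fin b) → Vertex b
  | [] => none
  | _ :: w => some w

/-- The neighbours of the non-root vertex `w` in cyclic order: number `0` is the parent, and
numbers `1, ..., b` are the children. -/
def nbr (w : List (Fin b)) : Fin (b + 1) → Vertex b :=
  Fin.cases (parent w) (fun k => some (k :: w))

/-- The `b`-ary tree as a graph: the edges join each non-root vertex to its parent. -/
def tree (b : ℕ) : SimpleGraph (Vertex b) :=
  SimpleGraph.fromRel fun x y => ∃ w : List (Fin b), x = some w ∧ y = parent w

/-- The level of a vertex: its graph distance from the root. -/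
def level (v : Vertex b) : ℕ := (tree b).dist none v

/-- A rotor configuration: the rotor at the non-root vertex `w` points to `nbr w (r w)`. -/
abbrev Config (b : ℕ) : Type := List (Fin b) → Fin (b + 1)

/-- The position of the particle together with the current rotors. -/
structure State (b : ℕ) where
  pos : Vertex b
  rotor : Config b

/-- One step of rotor walk. From the root the particle moves to the only child. At a non-root
vertex the rotor is first incremented (cyclically, in `Fin (b + 1)`), and then the particle moves
to the neighbour to which the rotor now points. -/
def step (s : State b) : State b :=
  match s.pos with
  | none => ⟨some [], s.rotor⟩
  | some w => ⟨nbr w (s.rotor w + 1), Function.update s.rotor w (s.rotor w + 1)⟩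

/-- The state after `t` steps of the walk started at the root with rotors `r`. -/
def walk (r : Config b) (t : ℕ) : State b := step^[t] ⟨none, r⟩

/-- The walk started at the root with rotors `r` returns to the root. -/
def Returns (r : Config b) : Prop := ∃ t, 0 < t ∧ (walk r t).pos = none

/-- The time of the first return to the root (used only if there is a return). -/
def returnTime (r : Config b) : ℕ := sInf {t | 0 < t ∧ (walk r t).pos = none}

/-- The particle started at the root with rotors `r` visits `v`, being stopped at its first return
to the root. -/
def Visits (r : Config b) (v : Vertex b) : Prop :=
  ∃ t, (∀ s, 0 < s → s < t → (walk r s).pos ≠ none) ∧ (walk r t).pos = v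

open Classical in
/-- The rotors after one particle has completed its walk. If it returns to the root, these are the
rotors at the time of the return. Otherwise it escapes to infinity and visits every vertex only
finitely many times, and these are the eventual values of the rotors (the last alternative does
not occur). -/
def rotorsAfterOne (r : Config b) : Config b :=
  if Returns r then (walk r (returnTime r)).rotor
  else fun w =>
    if h : ∃ k, ∀ᶠ t in atTop, (walk r t).rotor w = k then h.choose else r w

/-- The rotors after `n` successive particles, with initial rotors `r`. -/
def rotorsAfter (r : Config b) (n : ℕ) : Config b := rotorsAfterOne^[n] r

/-- The maximum distance from the root reached by the first `n` particles, with initial rotors `r`;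
it is `⊤` if one of them escapes to infinity. -/
def maxDepth (r : Config b) (n : ℕ) : ℕ∞ :=
  ⨆ (i : ℕ) (_ : i < n) (v : Vertex b) (_ : Visits (rotorsAfter r i) v), (level v : ℕ∞)

theorem adj_parent (w : List (Fin b)) : (tree b).Adj (parent w) (some w) := by
  rw [tree, SimpleGraph.fromRel_adj]
  refine ⟨?_, Or.inr ⟨w, rfl, rfl⟩⟩
  cases w with
  | nil => simp [parent]
  | cons k u => simp [parent]

theorem level_none : level (none : Vertex b) = 0 := by simp [level]

theorem level_some (w : List (Fin b)) : level (some w) = w.length + 1 := by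
  have up : ∀ u : List (Fin b), ∃ p : (tree b).Walk none (some u), p.length = u.length + 1 := by
    intro u
    induction u with
    | nil => exact ⟨.cons (adj_parent []) .nil, rfl⟩
    | cons k u ih =>
      obtain ⟨p, hp⟩ := ih
      exact ⟨p.concat (adj_parent (k :: u)), (p.length_concat _).trans (by rw [hp]; rfl)⟩
  have low : ∀ (x y : Vertex b) (p : (tree b).Walk x y),
      y.elim 0 (fun u => u.length + 1) ≤ x.elim 0 (fun u => u.length + 1) + p.length := by
    intro x y p
    induction p with
    | nil => simp
    | cons h p ih =>
      rw [tree, SimpleGraph.fromRel_adj] at h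
      rw [SimpleGraph.Walk.length_cons]
      obtain ⟨_, ⟨u, rfl, rfl⟩ | ⟨u, rfl, rfl⟩⟩ := h <;> cases u <;>
        simp [parent] at ih ⊢ <;> omega
  obtain ⟨p, hp⟩ := up w
  obtain ⟨q, hq⟩ := p.reachable.exists_walk_length_eq_dist
  have h1 := SimpleGraph.dist_le p
  have h2 := low _ _ q
  simp only [Option.elim] at h2
  unfold level
  omega

end RotorWalk

end

/-!
As long as the particles return to the root, each of them leaves every rotor that it has met
pointing to the parent. Hence a vertex is visited by one of the first `n` particles if and only if
its path from the root contains fewer than `n` steps from a vertex to a child whose number is at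
most the initial rotor there. For independent rotors, the probability `p h n` that a vertex at
depth `h` below a given one has fewer than `n` such steps on its path satisfies
`p (h + 1) n = 𝔼[1 - (1 - p h n) ^ (b - R) * (1 - p h (n - 1)) ^ R]`, which to first order reads
`p (h + 1) n ≈ (b - m) * p h n + m * p h (n - 1)` with `m = 𝔼 R`.

If `m > b - 1`, this is a contraction in `h`, so that `p (L * n) n ≤ 2 ^ (-n)` for a suitable `L`.
If `m = b - 1`, then `p h 1` is at least of order `1 / h`, and the second-order terms show that,
up to constants, `p h n ≤ p h (n + 1) ^ 2` and `p (2 * h) (n + 1) ^ 2 ≤ p h n + 1 / h`. Each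
further particle thus takes a square root, which gives the double exponential. In both cases
`1 - p (h + j) (n + j) ≤ (1 - p h n) ^ b ^ j` turns a lower bound on `p` into convergence to `1`.
-/

namespace RotorWalk

section Deterministic

variable {b : ℕ}

/-- The number of steps on the path from `w` to its descendant `u ++ w` that go from a vertex to a
child whose number is at most the current rotor there: a particle entering that vertex returns to
its parent before trying such a child. -/
def cost (r : Config b) (w : List (Fin b)) : List (Fin b) → ℕ
  | [] => 0
  | k :: u => cost r w u + if r (u ++ w) ≤ k.castSucc then 0 else 1

theorem cost_append_singleton (r : Config b) (w u : List (Fin b)) (k : Fin b) :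
    cost r w (u ++ [k]) = (if r w ≤ k.castSucc then 0 else 1) + cost r (k :: w) u := by
  induction u with
  | nil => simp [cost]
  | cons l u ih => simp only [List.cons_append, cost, ih, List.append_assoc, List.nil_append]; omega

theorem cost_congr {r r' : Config b} {w : List (Fin b)} (h : ∀ u, r (u ++ w) = r' (u ++ w)) :
    cost r w = cost r' w := by
  ext u
  induction u with
  | nil => rfl
  | cons l u ih => simp only [cost, ih, h]

theorem cost_mono (r : Config b) (w : List (Fin b)) {u v : List (Fin b)} (h : u <:+ v) :
    cost r w u ≤ cost r w v := by
  obtain ⟨t, rfl⟩ := h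
  induction t with
  | nil => rfl
  | cons k t ih => exact ih.trans (Nat.le_add_right _ _)

/-- The descendants of `w` at zero cost from `w`: those visited by a particle that enters `w`,
before it moves to the parent of `w`. -/
def liveSubtree (r : Config b) (w : List (Fin b)) : Set (List (Fin b)) :=
  {x | ∃ u, x = u ++ w ∧ cost r w u = 0}

theorem mem_liveSubtree_nil {r : Config b} {w : List (Fin b)} :
    w ∈ liveSubtree r [] ↔ cost r [] w = 0 := by
  simp [liveSubtree]

theorem self_mem_liveSubtree (r : Config b) (w : List (Fin b)) : w ∈ liveSubtree r w :=
  ⟨[], rfl, rfl⟩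

theorem cons_mem_liveSubtree_iff {r : Config b} {w : List (Fin b)} {k : Fin b} :
    k :: w ∈ liveSubtree r w ↔ r w ≤ k.castSucc := by
  constructor
  · rintro ⟨u, hu, hcost⟩
    obtain rfl : u = [k] := List.append_cancel_right (hu.symm.trans (List.singleton_append).symm)
    simpa [cost] using hcost
  · exact fun h => ⟨[k], rfl, by simpa [cost] using h⟩

theorem mem_liveSubtree_iff {r : Config b} {w x : List (Fin b)} :
    x ∈ liveSubtree r w ↔ x = w ∨ ∃ k : Fin b, r w ≤ k.castSucc ∧ x ∈ liveSubtree r (k :: w) := by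
  constructor
  · rintro ⟨u, rfl, hu⟩
    rcases List.eq_nil_or_concat' u with rfl | ⟨u, k, rfl⟩
    · exact Or.inl rfl
    · rw [cost_append_singleton] at hu
      exact Or.inr ⟨k, by grind, u, by simp, by omega⟩
  · rintro (rfl | ⟨k, hk, u, rfl, hu⟩)
    · exact self_mem_liveSubtree r _
    · exact ⟨u ++ [k], by simp, by rw [cost_append_singleton, if_pos hk, hu]⟩

theorem suffix_of_mem_liveSubtree {r : Config b} {w x : List (Fin b)} (h : x ∈ liveSubtree r w) :
    w <:+ x := by
  obtain ⟨u, rfl, -⟩ := h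
  exact List.suffix_append _ _

theorem liveSubtree_congr {r r' : Config b} {w : List (Fin b)} (h : ∀ x, w <:+ x → r x = r' x) :
    liveSubtree r w = liveSubtree r' w := by
  simp only [liveSubtree, cost_congr fun u => h _ (List.suffix_append u w)]

theorem eq_of_cons_suffix {k l : Fin b} {w x : List (Fin b)} (hk : k :: w <:+ x)
    (hl : l :: w <:+ x) : k = l := by
  have := List.suffix_of_suffix_length_le hk hl (by simp)
  simpa using this.eq_of_length (by simp)

theorem not_cons_suffix_self (k : Fin b) (w : List (Fin b)) : ¬ k :: w <:+ w := fun h => by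
  simpa using h.length_le

open Classical in
/-- The rotors `r` after those in `A` have been turned to the parent: the effect of a particle
that visits `A` and returns to the root. -/
noncomputable def clear (r : Config b) (A : Set (List (Fin b))) : Config b :=
  fun w => if w ∈ A then 0 else r w

theorem clear_of_mem {r : Config b} {A : Set (List (Fin b))} {w : List (Fin b)} (h : w ∈ A) :
    clear r A w = 0 :=
  if_pos h

theorem clear_of_notMem {r : Config b} {A : Set (List (Fin b))} {w : List (Fin b)} (h : w ∉ A) :
    clear r A w = r w :=
  if_neg h

theorem clear_clear (r : Config b) (A B : Set (List (Fin b))) :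
    clear (clear r A) B = clear r (A ∪ B) := by
  ext w
  by_cases hA : w ∈ A <;> by_cases hB : w ∈ B <;> simp [clear, hA, hB]

theorem clear_congr {r r' : Config b} {A : Set (List (Fin b))} (h : ∀ w ∉ A, r w = r' w) :
    clear r A = clear r' A := by
  ext w
  by_cases hw : w ∈ A <;> simp [clear, hw, h]

theorem clear_update {A : Set (List (Fin b))} {w : List (Fin b)} (h : w ∈ A) (r : Config b)
    (j : Fin (b + 1)) : clear (Function.update r w j) A = clear r A :=
  clear_congr fun _ hx => Function.update_of_ne (ne_of_mem_of_not_mem h hx).symm _ _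

/-- The walk goes from the state `s` to the state `s'` in finitely many steps, and `A` is the set
of positions occupied strictly before the end. -/
def Sweeps (s : State b) (A : Set (Vertex b)) (s' : State b) : Prop :=
  ∃ t, step^[t] s = s' ∧ (fun i => (step^[i] s).pos) '' Set.Iio t = A

theorem sweeps_step (s : State b) : Sweeps s {s.pos} (step s) := by
  refine ⟨1, rfl, ?_⟩
  have : Set.Iio 1 = {0} := by ext; simp
  rw [this, Set.image_singleton, Function.iterate_zero_apply]

theorem Sweeps.trans {s₁ s₂ s₃ : State b} {A B : Set (Vertex b)} (h₁ : Sweeps s₁ A s₂)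
    (h₂ : Sweeps s₂ B s₃) : Sweeps s₁ (A ∪ B) s₃ := by
  obtain ⟨t₁, rfl, rfl⟩ := h₁
  obtain ⟨t₂, rfl, rfl⟩ := h₂
  refine ⟨t₂ + t₁, Function.iterate_add_apply .., ?_⟩
  have hIio : Set.Iio (t₂ + t₁) = Set.Iio t₁ ∪ (· + t₁) '' Set.Iio t₂ := by
    ext i
    simp only [Set.mem_Iio, Set.mem_union, Set.mem_image]
    exact ⟨fun h => (lt_or_ge i t₁).imp_right fun hi => ⟨i - t₁, by omega, by omega⟩, by grind⟩
  simp only [hIio, Set.image_union, Set.image_image, Function.iterate_add_apply]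

theorem liveSubtree_of_eq_last {r : Config b} {w : List (Fin b)} (h : r w = Fin.last b) :
    liveSubtree r w = {w} := by
  ext x
  rw [mem_liveSubtree_iff, Set.mem_singleton_iff, or_iff_left]
  rintro ⟨k, hk, -⟩
  exact (h ▸ hk).not_gt (Fin.castSucc_lt_last k)

theorem liveSubtree_update_cons (r : Config b) (w : List (Fin b)) (j : Fin (b + 1)) (k : Fin b) :
    liveSubtree (Function.update r w j) (k :: w) = liveSubtree r (k :: w) :=
  liveSubtree_congr fun x hx => Function.update_of_ne
    (by rintro rfl; exact not_cons_suffix_self k _ hx) _ _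

/-- The rotors at the second arrival at `w` of a particle that enters `w` when the rotor there
points to number `k`, and has meanwhile visited the live subtree of the child `k :: w`. -/
noncomputable def afterChild (r : Config b) (w : List (Fin b)) (k : Fin b) : Config b :=
  clear (Function.update r w k.succ) (liveSubtree r (k :: w))

theorem afterChild_self (r : Config b) (w : List (Fin b)) (k : Fin b) :
    afterChild r w k w = k.succ := by
  rw [afterChild, clear_of_notMem, Function.update_self]
  exact fun h => not_cons_suffix_self k w (suffix_of_mem_liveSubtree h)

theorem liveSubtree_afterChild_cons {k l : Fin b} (h : k ≠ l) (r : Config b) (w : List (Fin b)) :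
    liveSubtree (afterChild r w k) (l :: w) = liveSubtree r (l :: w) := by
  refine liveSubtree_congr fun x hx => ?_
  rw [afterChild, clear_of_notMem fun hk => h (eq_of_cons_suffix (suffix_of_mem_liveSubtree hk) hx),
    Function.update_of_ne]
  exact fun hxw => not_cons_suffix_self l w (hxw ▸ hx)

theorem liveSubtree_eq_union_afterChild {r : Config b} {w : List (Fin b)} {k : Fin b}
    (hk : r w = k.castSucc) :
    liveSubtree r w = liveSubtree r (k :: w) ∪ liveSubtree (afterChild r w k) w := by
  have hlt (l : Fin b) : k.succ ≤ l.castSucc ↔ k < l := Iff.rfl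
  ext x
  rw [Set.mem_union, mem_liveSubtree_iff, mem_liveSubtree_iff (r := afterChild r w k),
    afterChild_self, hk]
  simp only [Fin.castSucc_le_castSucc_iff, hlt]
  constructor
  · rintro (h | ⟨l, hl, h⟩)
    · exact Or.inr (Or.inl h)
    · rcases hl.eq_or_lt with rfl | hl
      · exact Or.inl h
      · exact Or.inr (Or.inr ⟨l, hl, by rwa [liveSubtree_afterChild_cons hl.ne]⟩)
  · rintro (h | h | ⟨l, hl, h⟩)
    · exact Or.inr ⟨k, le_rfl, h⟩
    · exact Or.inl h
    · exact Or.inr ⟨l, hl.le, by rwa [liveSubtree_afterChild_cons hl.ne] at h⟩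

theorem liveSubtree_cons_ssubset {r : Config b} {w : List (Fin b)} {k : Fin b}
    (hk : r w = k.castSucc) : liveSubtree r (k :: w) ⊂ liveSubtree r w :=
  ⟨liveSubtree_eq_union_afterChild hk ▸ Set.subset_union_left, fun h =>
    not_cons_suffix_self k w (suffix_of_mem_liveSubtree (h (self_mem_liveSubtree r w)))⟩

theorem liveSubtree_afterChild_ssubset {r : Config b} {w : List (Fin b)} {k : Fin b}
    (hk : r w = k.castSucc) : liveSubtree (afterChild r w k) w ⊂ liveSubtree r w := by
  refine ⟨liveSubtree_eq_union_afterChild hk ▸ Set.subset_union_right, fun h => ?_⟩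
  have hmem := h (cons_mem_liveSubtree_iff.2 hk.le)
  rw [cons_mem_liveSubtree_iff, afterChild_self] at hmem
  exact hmem.not_gt (Fin.castSucc_lt_succ)

theorem clear_afterChild {r : Config b} {w : List (Fin b)} {k : Fin b} (hk : r w = k.castSucc) :
    clear (afterChild r w k) (liveSubtree (afterChild r w k) w) = clear r (liveSubtree r w) := by
  rw [liveSubtree_eq_union_afterChild hk,
    ← clear_update (Or.inr (self_mem_liveSubtree _ w)) r k.succ, ← clear_clear, ← afterChild]

theorem sweeps_liveSubtree {r : Config b} {w : List (Fin b)} (h : (liveSubtree r w).Finite) :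
    Sweeps ⟨some w, r⟩ (some '' liveSubtree r w) ⟨parent w, clear r (liveSubtree r w)⟩ := by
  induction hn : (liveSubtree r w).ncard using Nat.strong_induction_on generalizing r w with
  | h n ih =>
    subst hn
    have sweeps_of_ssubset {r' : Config b} {w' : List (Fin b)}
        (hlt : liveSubtree r' w' ⊂ liveSubtree r w) :=
      ih _ (Set.ncard_lt_ncard hlt h) (h.subset hlt.subset) rfl
    rcases Fin.eq_castSucc_or_eq_last (r w) with ⟨k, hk⟩ | hlast
    · have enter : Sweeps ⟨some w, r⟩ {some w} ⟨some (k :: w), Function.update r w k.succ⟩ := by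
        simpa [step, hk, Fin.coeSucc_eq_succ, nbr] using sweeps_step ⟨some w, r⟩
      have child : Sweeps ⟨some (k :: w), Function.update r w k.succ⟩
          (some '' liveSubtree r (k :: w)) ⟨some w, afterChild r w k⟩ := by
        have hlive := liveSubtree_update_cons r w k.succ k
        have := sweeps_of_ssubset (hlive ▸ liveSubtree_cons_ssubset hk)
        rwa [hlive] at this
      have rest := sweeps_of_ssubset (liveSubtree_afterChild_ssubset hk)
      have hunion := (enter.trans child).trans rest
      rw [clear_afterChild hk, Set.union_assoc, ← Set.image_union,
        ← liveSubtree_eq_union_afterChild hk] at hunion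
      rwa [Set.union_eq_right.2] at hunion
      exact Set.singleton_subset_iff.2 (Set.mem_image_of_mem _ (self_mem_liveSubtree r w))
    · have hclear : clear r {w} = Function.update r w 0 := by
        ext x
        by_cases hx : x = w <;> simp [clear, hx]
      rw [liveSubtree_of_eq_last hlast, Set.image_singleton, hclear]
      simpa [step, hlast, nbr] using sweeps_step ⟨some w, r⟩

theorem exists_first_return {r : Config b} (h : {w | cost r [] w = 0}.Finite) :
    ∃ t, IsLeast {t | 0 < t ∧ (walk r t).pos = none} t ∧
      (walk r t).rotor = clear r {w | cost r [] w = 0} ∧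
      ∀ w, (∃ i < t, (walk r i).pos = some w) ↔ cost r [] w = 0 := by
  have hlive : liveSubtree r [] = {w | cost r [] w = 0} := Set.ext fun _ => mem_liveSubtree_nil
  rw [← hlive] at h
  obtain ⟨t, hend, hpos⟩ := sweeps_liveSubtree h
  have hwalk (i : ℕ) : walk r (i + 1) = step^[i] ⟨some [], r⟩ := Function.iterate_succ_apply ..
  simp only [hlive, ← hwalk] at hend hpos
  have hvisit (w : List (Fin b)) : (∃ i < t, (walk r (i + 1)).pos = some w) ↔ cost r [] w = 0 := by
    simpa using Set.ext_iff.1 hpos (some w)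
  refine ⟨t + 1, ⟨⟨t.succ_pos, by rw [hend, parent]⟩, ?_⟩, by rw [hend], fun w => ?_⟩
  · rintro (_ | i) ⟨hi, hnone⟩
    · exact absurd hi (lt_irrefl 0)
    · by_contra! hlt
      have hmem := hpos.subset ⟨i, Nat.lt_of_succ_lt_succ hlt, rfl⟩
      simp [hnone] at hmem
  · rw [← hvisit]
    refine ⟨?_, fun ⟨i, hi, hp⟩ => ⟨i + 1, by omega, hp⟩⟩
    rintro ⟨_ | i, hi, hp⟩
    · simp [walk] at hp
    · exact ⟨i, by omega, hp⟩

theorem rotorsAfterOne_eq_clear {r : Config b} (h : {w | cost r [] w = 0}.Finite) :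
    rotorsAfterOne r = clear r {w | cost r [] w = 0} := by
  obtain ⟨t, ht, hrotor, -⟩ := exists_first_return h
  rw [rotorsAfterOne, if_pos ⟨t, ht.1⟩, returnTime, ht.csInf_eq, hrotor]

theorem visits_iff_cost_eq_zero {r : Config b} (h : {w | cost r [] w = 0}.Finite)
    (w : List (Fin b)) : Visits r (some w) ↔ cost r [] w = 0 := by
  obtain ⟨t, ht, -, hvisit⟩ := exists_first_return h
  rw [← hvisit]
  constructor
  · rintro ⟨s, hs, hp⟩
    refine ⟨s, lt_of_not_ge fun hts => ?_, hp⟩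
    rcases hts.eq_or_lt with rfl | hlt
    · simp [ht.1.2] at hp
    · exact hs t ht.1.1 hlt ht.1.2
  · rintro ⟨s, hst, hp⟩
    exact ⟨s, fun i hi his hnone => (his.trans hst).not_ge (ht.2 ⟨hi, hnone⟩), hp⟩

theorem cost_clear (r : Config b) (i : ℕ) (w : List (Fin b)) :
    cost (clear r {x | cost r [] x < i}) [] w = cost r [] w - i := by
  induction w with
  | nil => simp [cost]
  | cons k w ih =>
    simp only [cost, List.append_nil, ih]
    by_cases h : cost r [] w < i
    · rw [clear_of_mem h, if_pos (Fin.zero_le _)]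
      split_ifs <;> omega
    · rw [clear_of_notMem h]
      omega

theorem finite_cost_clear_eq_zero {r : Config b} {i n : ℕ} (h : {w | cost r [] w < n}.Finite)
    (hi : i < n) : {w | cost (clear r {x | cost r [] x < i}) [] w = 0}.Finite :=
  h.subset fun w (hw : cost _ [] w = 0) => by
    rw [cost_clear] at hw
    exact Nat.lt_of_le_of_lt (Nat.sub_eq_zero_iff_le.1 hw) hi

theorem rotorsAfter_eq_clear {r : Config b} {i n : ℕ} (h : {w | cost r [] w < n}.Finite)
    (hi : i ≤ n) : rotorsAfter r i = clear r {w | cost r [] w < i} := by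
  induction i with
  | zero => ext; simp [rotorsAfter, clear]
  | succ i ih =>
    rw [rotorsAfter, Function.iterate_succ_apply', ← rotorsAfter, ih (by omega),
      rotorsAfterOne_eq_clear (finite_cost_clear_eq_zero h hi), clear_clear]
    congr 1
    ext w
    simp only [Set.mem_union, Set.mem_ofPred_eq, cost_clear]
    omega

theorem visits_rotorsAfter_iff {r : Config b} {i n : ℕ} (h : {w | cost r [] w < n}.Finite)
    (hi : i < n) (w : List (Fin b)) : Visits (rotorsAfter r i) (some w) ↔ cost r [] w ≤ i := by
  rw [rotorsAfter_eq_clear h hi.le, visits_iff_cost_eq_zero (finite_cost_clear_eq_zero h hi),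
    cost_clear, Nat.sub_eq_zero_iff_le]

/-- No descendant of `v` at depth `h` below `v` has cost less than `n` from `v`. -/
def Unreached (r : Config b) (h n : ℕ) (v : List (Fin b)) : Prop :=
  ∀ u : List (Fin b), u.length = h → n ≤ cost r v u

theorem Unreached.length_lt {r : Config b} {h n : ℕ} {v u : List (Fin b)}
    (hr : Unreached r h n v) (hu : cost r v u < n) : u.length < h := by
  by_contra! hlen
  have := hr (u.drop (u.length - h)) (by simp; omega)
  exact (this.trans (cost_mono r v (u.drop_suffix _))).not_gt hu

theorem Unreached.finite_cost_lt {r : Config b} {h n : ℕ} {v : List (Fin b)}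
    (hr : Unreached r h n v) : {u | cost r v u < n}.Finite :=
  (List.finite_length_lt (Fin b) h).subset fun _ => hr.length_lt

theorem Unreached.maxDepth_le {r : Config b} {h n : ℕ} (hr : Unreached r h n []) :
    maxDepth r n ≤ h := by
  refine iSup₂_le fun i hi => iSup₂_le fun v hv => ?_
  rcases v with _ | w
  · simp [level_none]
  · rw [visits_rotorsAfter_iff hr.finite_cost_lt hi] at hv
    rw [level_some]
    exact_mod_cast hr.length_lt (hv.trans_lt hi)

theorem length_lt_maxDepth {r : Config b} {n : ℕ} (h : {w | cost r [] w < n}.Finite)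
    {w : List (Fin b)} (hw : cost r [] w < n) : w.length < maxDepth r n := by
  have hvisits := (visits_rotorsAfter_iff h hw w).2 le_rfl
  have hle : (level (some w) : ℕ∞) ≤ maxDepth r n :=
    le_iSup₂_of_le _ hw (le_iSup₂_of_le _ hvisits le_rfl)
  rw [level_some] at hle
  exact lt_of_lt_of_le (by exact_mod_cast Nat.lt_succ_self _) hle

theorem exists_maxDepth_eq {r : Config b} {l h n : ℕ} (hl : ¬ Unreached r l n [])
    (hh : Unreached r h n []) : ∃ d : ℕ, maxDepth r n = d ∧ l < d ∧ d ≤ h := by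
  simp only [Unreached, not_forall, not_le] at hl
  obtain ⟨w, rfl, hw⟩ := hl
  have hle := hh.maxDepth_le
  obtain ⟨d, hd⟩ := ENat.ne_top_iff_exists.1 (ne_top_of_le_ne_top (ENat.natCast_ne_top h) hle)
  have hlt := length_lt_maxDepth hh.finite_cost_lt hw
  rw [← hd] at hle hlt
  exact ⟨d, hd.symm, by exact_mod_cast hlt, by exact_mod_cast hle⟩

end Deterministic

section Probability

variable {b : ℕ}

theorem iIndep_iSup_of_pairwise_disjoint {Ω ι κ : Type*} [mΩ : MeasurableSpace Ω] {P : Measure Ω}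
    [IsProbabilityMeasure P] {m : ι → MeasurableSpace Ω} (hle : ∀ i, m i ≤ mΩ) (hm : iIndep m P)
    {S : κ → Set ι} (hS : Pairwise (Function.onFun Disjoint S)) :
    iIndep (fun k => ⨆ i ∈ S k, m i) P := by
  classical
  rw [iIndep_iff]
  intro s E hE
  induction s using Finset.induction_on with
  | empty => simp
  | insert k s hk ih =>
    rw [Finset.forall_mem_insert] at hE
    rw [Finset.prod_insert hk, Finset.set_biInter_insert, ← ih hE.2]
    have hdisj : Disjoint (S k) (⋃ l ∈ s, S l) :=
      Set.disjoint_iUnion₂_right.2 fun l hl => hS fun h => hk (h ▸ hl)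
    refine (Indep_iff _ _ _).1 (indep_iSup_of_disjoint hle hm hdisj) _ _ hE.1
      (s.measurableSet_biInter fun l hl => ?_)
    have hsub : ⨆ i ∈ S l, m i ≤ ⨆ i ∈ ⋃ l ∈ s, S l, m i :=
      biSup_mono fun i hi => Set.mem_biUnion hl hi
    exact hsub _ (hE.2 l hl)

theorem measureReal_eq_sum_preimage_singleton_inter {Ω β : Type*} [MeasurableSpace Ω]
    (P : Measure Ω) [IsFiniteMeasure P] [Fintype β] [MeasurableSpace β]
    [MeasurableSingletonClass β] {f : Ω → β} (hf : Measurable f) (A : Set Ω) :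
    P.real A = ∑ y, P.real (f ⁻¹' {y} ∩ A) := by
  have hmeas (y : β) : MeasurableSet (f ⁻¹' {y}) := hf (measurableSet_singleton y)
  have := sum_measureReal_preimage_singleton (μ := P.restrict A) Finset.univ fun y _ => hmeas y
  simpa [measureReal_restrict_apply (hmeas _)] using this.symm

theorem measurable_cost {Ω : Type*} [MeasurableSpace Ω] {R : List (Fin b) → Ω → Fin (b + 1)}
    {v : List (Fin b)} (hR : ∀ w, v <:+ w → Measurable (R w)) (u : List (Fin b)) :
    Measurable fun ω => cost (fun w => R w ω) v u := by
  induction u with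
  | nil => exact measurable_const
  | cons k u ih =>
    have hmeas : MeasurableSet {ω | R (u ++ v) ω ≤ k.castSucc} :=
      measurableSet_le (hR _ (List.suffix_append u v)) measurable_const
    exact ih.add (measurable_const.ite hmeas measurable_const)

theorem measurableSet_unreached {Ω : Type*} [MeasurableSpace Ω]
    {R : List (Fin b) → Ω → Fin (b + 1)} {v : List (Fin b)}
    (hR : ∀ w, v <:+ w → Measurable (R w)) (h n : ℕ) :
    MeasurableSet {ω | Unreached (fun w => R w ω) h n v} := by
  simp only [Unreached, Set.ofPred_forall]
  exact .iInter fun u => .iInter fun _ => measurableSet_le measurable_const (measurable_cost hR u)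

theorem unreached_zero (r : Config b) (n : ℕ) (v : List (Fin b)) :
    Unreached r 0 n v ↔ n = 0 := by
  simp [Unreached, cost]

theorem unreached_succ (r : Config b) (h n : ℕ) (v : List (Fin b)) :
    Unreached r (h + 1) n v ↔
      ∀ k : Fin b, Unreached r h (if r v ≤ k.castSucc then n else n - 1) (k :: v) := by
  constructor
  · intro H k u hu
    have := H (u ++ [k]) (by simp [hu])
    grind [cost_append_singleton]
  · intro H u hu
    rcases List.eq_nil_or_concat' u with rfl | ⟨u, k, rfl⟩
    · simp at hu
    · have := H k u (by simpa using hu)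
      grind [cost_append_singleton]

/-- The probability that some vertex at depth `h` below a given one has cost less than `n` from
it, when the rotors are independent with law `μ`. -/
noncomputable def reach (μ : Measure (Fin (b + 1))) : ℕ → ℕ → ℝ
  | 0, n => if n = 0 then 0 else 1
  | h + 1, n => ∫ j, 1 - (1 - reach μ h n) ^ (b - (j : ℕ)) * (1 - reach μ h (n - 1)) ^ (j : ℕ) ∂μ

theorem one_sub_reach_succ (μ : Measure (Fin (b + 1))) [IsProbabilityMeasure μ] (h n : ℕ) :
    1 - reach μ (h + 1) n =
      ∫ j, (1 - reach μ h n) ^ (b - (j : ℕ)) * (1 - reach μ h (n - 1)) ^ (j : ℕ) ∂μ := by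
  rw [reach, integral_sub .of_finite .of_finite]
  simp

theorem prod_ite_le_castSucc {M : Type*} [CommMonoid M] (j : Fin (b + 1)) (x y : M) :
    ∏ k : Fin b, (if j ≤ k.castSucc then x else y) = x ^ (b - (j : ℕ)) * y ^ (j : ℕ) := by
  have hlt : Finset.card {k : Fin b | k.castSucc < j} = j := by
    simp only [Fin.lt_def, Fin.val_castSucc]
    rw [Fin.card_filter_val_lt, min_eq_right (Nat.lt_succ_iff.1 j.2)]
  have hge := Finset.card_filter_add_card_filter_not (s := Finset.univ)
    fun k : Fin b => k.castSucc < j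
  rw [hlt, Finset.card_univ, Fintype.card_fin] at hge
  simp only [← not_lt, ite_not]
  rw [Finset.prod_ite, Finset.prod_const, Finset.prod_const, hlt, mul_comm,
    Nat.eq_sub_of_add_eq' hge]

/-- The rotors below `v` split into independent blocks: the rotor at `v` itself and those in the
subtree of each child. -/
def block (v : List (Fin b)) : Option (Fin b) → Set (List (Fin b))
  | none => {v}
  | some k => {w | k :: v <:+ w}

theorem pairwise_disjoint_block (v : List (Fin b)) :
    Pairwise (Function.onFun Disjoint (block v)) := by
  rintro (_ | k) (_ | l) hkl
  · exact absurd rfl hkl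
  · exact Set.disjoint_singleton_left.2 (not_cons_suffix_self l v)
  · exact Set.disjoint_singleton_right.2 (not_cons_suffix_self k v)
  · exact Set.disjoint_left.2 fun w hk hl => hkl (congrArg some (eq_of_cons_suffix hk hl))

theorem measureReal_preimage_inter_unreached {Ω : Type*} [MeasurableSpace Ω] {P : Measure Ω}
    [IsProbabilityMeasure P] {R : List (Fin b) → Ω → Fin (b + 1)} (hR : ∀ v, Measurable (R v))
    (hind : iIndepFun R P) (v : List (Fin b)) (j : Fin (b + 1)) (h : ℕ) (n : Fin b → ℕ) :
    P.real (R v ⁻¹' {j} ∩ ⋂ k, {ω | Unreached (fun w => R w ω) h (n k) (k :: v)}) =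
      P.real (R v ⁻¹' {j}) * ∏ k, P.real {ω | Unreached (fun w => R w ω) h (n k) (k :: v)} := by
  let 𝓕 (o : Option (Fin b)) : MeasurableSpace Ω :=
    ⨆ w ∈ block v o, MeasurableSpace.comap (R w) inferInstance
  let E (o : Option (Fin b)) : Set Ω :=
    o.elim (R v ⁻¹' {j}) fun k => {ω | Unreached (fun w => R w ω) h (n k) (k :: v)}
  have hmeas {o : Option (Fin b)} {w : List (Fin b)} (hw : w ∈ block v o) : Measurable[𝓕 o] (R w) :=
    measurable_iff_comap_le.2 (le_iSup₂_of_le w hw le_rfl)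
  have hE : ∀ o, MeasurableSet[𝓕 o] (E o)
    | none => hmeas rfl (measurableSet_singleton j)
    | some k => @measurableSet_unreached b Ω (𝓕 (some k)) R (k :: v) (fun w hw => hmeas hw) h (n k)
  have hindep := iIndep_iSup_of_pairwise_disjoint (fun w => (hR w).comap_le) hind
    (pairwise_disjoint_block v)
  have := congrArg ENNReal.toReal (hindep.meas_iInter hE)
  rwa [ENNReal.toReal_prod, Fintype.prod_option, Set.iInter_option] at this

theorem measureReal_unreached {Ω : Type*} [MeasurableSpace Ω] {P : Measure Ω}
    [IsProbabilityMeasure P] {R : List (Fin b) → Ω → Fin (b + 1)} (hR : ∀ v, Measurable (R v))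
    (hind : iIndepFun R P) {μ : Measure (Fin (b + 1))} [IsProbabilityMeasure μ]
    (hμ : ∀ v, P.map (R v) = μ) (h n : ℕ) (v : List (Fin b)) :
    P.real {ω | Unreached (fun w => R w ω) h n v} = 1 - reach μ h n := by
  induction h generalizing n v with
  | zero => by_cases hn : n = 0 <;> simp [unreached_zero, reach, hn]
  | succ h ih =>
    have fiber (j : Fin (b + 1)) :
        R v ⁻¹' {j} ∩ {ω | Unreached (fun w => R w ω) (h + 1) n v} = R v ⁻¹' {j} ∩
          ⋂ k : Fin b, {ω | Unreached (fun w => R w ω) h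
            (if j ≤ k.castSucc then n else n - 1) (k :: v)} := by
      ext ω
      simp only [unreached_succ, Set.mem_inter_iff, Set.mem_iInter, Set.mem_ofPred_eq]
      exact and_congr_right fun hj => by rw [show R v ω = j from hj]
    have hlaw (j : Fin (b + 1)) : P.real (R v ⁻¹' {j}) = μ.real {j} := by
      rw [← hμ v, map_measureReal_apply (hR v) (measurableSet_singleton j)]
    have hsplit (j : Fin (b + 1)) (k : Fin b) :
        1 - reach μ h (if j ≤ k.castSucc then n else n - 1) =
          if j ≤ k.castSucc then 1 - reach μ h n else 1 - reach μ h (n - 1) := by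
      split_ifs <;> rfl
    rw [measureReal_eq_sum_preimage_singleton_inter P (hR v)]
    simp only [fiber, measureReal_preimage_inter_unreached hR hind, hlaw, ih, hsplit,
      prod_ite_le_castSucc]
    rw [one_sub_reach_succ, integral_fintype .of_finite]
    rfl

end Probability

section Reach

variable {b : ℕ} (μ : Measure (Fin (b + 1)))

theorem reach_zero_right (h : ℕ) : reach μ h 0 = 0 := by
  induction h with
  | zero => simp [reach]
  | succ h ih => simp [reach, ih]

variable [IsProbabilityMeasure μ]

theorem reach_mem_Icc (h n : ℕ) : reach μ h n ∈ Set.Icc (0 : ℝ) 1 := by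
  induction h generalizing n with
  | zero => by_cases hn : n = 0 <;> simp [reach, hn]
  | succ h ih =>
    have hnonneg (i : ℕ) : 0 ≤ 1 - reach μ h i := sub_nonneg.2 (ih i).2
    have hle (i : ℕ) : 1 - reach μ h i ≤ 1 := sub_le_self 1 (ih i).1
    suffices 1 - reach μ (h + 1) n ∈ Set.Icc (0 : ℝ) 1 from
      ⟨by linarith [this.2], by linarith [this.1]⟩
    rw [one_sub_reach_succ]
    refine ⟨integral_nonneg fun j => mul_nonneg (pow_nonneg (hnonneg _) _)
      (pow_nonneg (hnonneg _) _), ?_⟩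
    have hbound (j : Fin (b + 1)) :
        (1 - reach μ h n) ^ (b - (j : ℕ)) * (1 - reach μ h (n - 1)) ^ (j : ℕ) ≤ 1 :=
      mul_le_one₀ (pow_le_one₀ (hnonneg _) (hle _)) (pow_nonneg (hnonneg _) _)
        (pow_le_one₀ (hnonneg _) (hle _))
    simpa using integral_mono (μ := μ) .of_finite .of_finite hbound

theorem one_sub_reach_nonneg (h n : ℕ) : 0 ≤ 1 - reach μ h n :=
  sub_nonneg.2 (reach_mem_Icc μ h n).2

variable {μ} in
theorem reach_succ_mono {h h' n n' : ℕ} (hn : reach μ h n ≤ reach μ h' n')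
    (hpred : reach μ h (n - 1) ≤ reach μ h' (n' - 1)) :
    reach μ (h + 1) n ≤ reach μ (h' + 1) n' := by
  have hnonneg := one_sub_reach_nonneg μ h'
  refine integral_mono .of_finite .of_finite fun j => sub_le_sub_left ?_ _
  exact mul_le_mul (pow_le_pow_left₀ (hnonneg _) (sub_le_sub_left hn _) _)
    (pow_le_pow_left₀ (hnonneg _) (sub_le_sub_left hpred _) _) (pow_nonneg (hnonneg _) _)
    (pow_nonneg (one_sub_reach_nonneg μ h _) _)

theorem reach_monotone (h : ℕ) : Monotone (reach μ h) := by
  refine monotone_nat_of_le_succ fun n => ?_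
  induction h generalizing n with
  | zero => cases n <;> simp [reach]
  | succ h ih =>
    refine reach_succ_mono (ih n) ?_
    cases n with
    | zero => exact le_rfl
    | succ n => exact ih n

theorem reach_antitone (n : ℕ) : Antitone fun h => reach μ h n := by
  refine antitone_nat_of_succ_le fun h => ?_
  induction h generalizing n with
  | zero =>
    cases n with
    | zero => rw [reach_zero_right, reach_zero_right]
    | succ n => simpa [reach] using (reach_mem_Icc μ 1 (n + 1)).2
  | succ h ih => exact reach_succ_mono (ih n) (ih (n - 1))

theorem one_sub_reach_succ_succ_le_pow (h n : ℕ) :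
    1 - reach μ (h + 1) (n + 1) ≤ (1 - reach μ h n) ^ b := by
  have hnonneg := one_sub_reach_nonneg μ h
  have hbound (j : Fin (b + 1)) : (1 - reach μ h (n + 1)) ^ (b - (j : ℕ)) *
      (1 - reach μ h n) ^ (j : ℕ) ≤ (1 - reach μ h n) ^ b :=
    calc _ ≤ (1 - reach μ h n) ^ (b - (j : ℕ)) * (1 - reach μ h n) ^ (j : ℕ) := by
          gcongr
          · exact pow_nonneg (hnonneg n) _
          · exact hnonneg (n + 1)
          · exact reach_monotone μ h n.le_succ
      _ = (1 - reach μ h n) ^ b := by rw [← pow_add, Nat.sub_add_cancel (Nat.lt_succ_iff.1 j.2)]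
  rw [one_sub_reach_succ]
  simpa using integral_mono (μ := μ) .of_finite .of_finite hbound

theorem one_sub_reach_add_add_le_pow (h n j : ℕ) :
    1 - reach μ (h + j) (n + j) ≤ (1 - reach μ h n) ^ b ^ j := by
  induction j with
  | zero => simp
  | succ j ih =>
    calc _ ≤ (1 - reach μ (h + j) (n + j)) ^ b := one_sub_reach_succ_succ_le_pow μ _ _
      _ ≤ ((1 - reach μ h n) ^ b ^ j) ^ b := pow_le_pow_left₀ (one_sub_reach_nonneg μ _ _) ih _
      _ = (1 - reach μ h n) ^ b ^ (j + 1) := by rw [← pow_mul, pow_succ]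

theorem one_sub_mul_add_sq_le_pow {q : ℝ} (hq : q ≤ 1) (i : ℕ) :
    1 - i * q + (if 2 ≤ i then q ^ 2 else 0) ≤ (1 - q) ^ i := by
  rcases lt_or_ge i 2 with hi | hi
  · interval_cases i <;> norm_num
  · rw [if_pos hi]
    induction i, hi using Nat.le_induction with
    | base => exact le_of_eq (by push_cast; ring)
    | succ i hi ih =>
      have hi' : (2 : ℝ) ≤ i := by exact_mod_cast hi
      have hcube : 0 ≤ q ^ 2 * (1 - q) := mul_nonneg (sq_nonneg q) (sub_nonneg.2 hq)
      have hmul := mul_le_mul_of_nonneg_right ih (sub_nonneg.2 hq)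
      rw [pow_succ (1 - q)]
      push_cast
      nlinarith [mul_nonneg (sub_nonneg.2 hi') (sq_nonneg q)]

theorem one_sub_pow_mul_pow_le {p q : ℝ} (hp : p ∈ Set.Icc (0 : ℝ) 1) (hq : q ∈ Set.Icc (0 : ℝ) 1)
    (i j : ℕ) :
    1 - (1 - q) ^ i * (1 - p) ^ j ≤ i * q + j * p - if 2 ≤ i then q ^ 2 else 0 := by
  have hpow_q := one_sub_mul_add_sq_le_pow hq.2 i
  have hpow_p : 1 - j * p ≤ (1 - p) ^ j := by
    have := one_add_mul_le_pow (a := -p) (by linarith [hp.2]) j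
    rwa [← sub_eq_add_neg, mul_neg, ← sub_eq_add_neg] at this
  have hle_q : (1 - q) ^ i ≤ 1 := pow_le_one₀ (by linarith [hq.2]) (by linarith [hq.1])
  have hle_p : (1 - p) ^ j ≤ 1 := pow_le_one₀ (by linarith [hp.2]) (by linarith [hp.1])
  linarith [mul_nonneg (sub_nonneg.2 hle_q) (sub_nonneg.2 hle_p)]

theorem one_sub_pow_mul_one_add_mul_le_one {q : ℝ} (hq : q ∈ Set.Icc (0 : ℝ) 1) (i : ℕ) :
    (1 - q) ^ i * (1 + i * q) ≤ 1 :=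
  calc (1 - q) ^ i * (1 + i * q) ≤ (1 - q) ^ i * (1 + q) ^ i :=
        mul_le_mul_of_nonneg_left (one_add_mul_le_pow (by linarith [hq.1]) i)
          (pow_nonneg (by linarith [hq.2]) i)
    _ = (1 - q ^ 2) ^ i := by rw [← mul_pow]; ring
    _ ≤ 1 := pow_le_one₀ (by nlinarith [hq.1, hq.2]) (by linarith [sq_nonneg q])

theorem add_le_one_add_mul_one_sub_pow_mul_pow {p q : ℝ} (hp : 0 ≤ p) (hpq : p ≤ q) (hq : q ≤ 1)
    (i j : ℕ) :
    i * q + j * p ≤ (1 + (i + j) * q) * (1 - (1 - q) ^ i * (1 - p) ^ j) := by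
  have hnonneg_q : 0 ≤ (1 - q) ^ i := pow_nonneg (by linarith) i
  have hnonneg_p : 0 ≤ (1 - p) ^ j := pow_nonneg (by linarith) j
  have hle_q := one_sub_pow_mul_one_add_mul_le_one ⟨hp.trans hpq, hq⟩ i
  have hle_p := one_sub_pow_mul_one_add_mul_le_one ⟨hp, hpq.trans hq⟩ j
  set x := (1 - q) ^ i * (1 - p) ^ j with hx
  have hx_nonneg : 0 ≤ x := mul_nonneg hnonneg_q hnonneg_p
  have hiq : 0 ≤ i * q := mul_nonneg i.cast_nonneg (hp.trans hpq)
  have hjp : 0 ≤ j * p := mul_nonneg j.cast_nonneg hp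
  have hprod : x * (1 + (i * q + j * p)) ≤ 1 :=
    calc x * (1 + (i * q + j * p)) ≤ x * ((1 + i * q) * (1 + j * p)) :=
          mul_le_mul_of_nonneg_left (by nlinarith [mul_nonneg hiq hjp]) hx_nonneg
      _ = ((1 - q) ^ i * (1 + i * q)) * ((1 - p) ^ j * (1 + j * p)) := by rw [hx]; ring
      _ ≤ 1 := mul_le_one₀ hle_q (mul_nonneg hnonneg_p (by linarith)) hle_p
  have hx_le : x ≤ 1 := by nlinarith
  have hsum : i * q + j * p ≤ (i + j) * q := by
    nlinarith [mul_le_mul_of_nonneg_left hpq (Nat.cast_nonneg (α := ℝ) j)]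
  calc i * q + j * p ≤ (1 + (i * q + j * p)) * (1 - x) := by linarith
    _ ≤ (1 + (i + j) * q) * (1 - x) :=
        mul_le_mul_of_nonneg_right (by linarith) (sub_nonneg.2 hx_le)

/-- The mean of the law `μ` of the rotors. -/
noncomputable def mean (μ : Measure (Fin (b + 1))) : ℝ := ∫ j, ((j : ℕ) : ℝ) ∂μ

/-- The probability that a rotor points to one of the first `b - 2` children or to the parent, so
that the first particle can enter at least two children. This gives the recursion for `reach` its
quadratic term. -/
noncomputable def branchProb (μ : Measure (Fin (b + 1))) : ℝ := μ.real {j | (j : ℕ) + 2 ≤ b}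

theorem integral_sub_mul_add_mul (q p : ℝ) :
    ∫ j, (((b - (j : ℕ) : ℕ) : ℝ) * q + ((j : ℕ) : ℝ) * p) ∂μ = (b - mean μ) * q + mean μ * p := by
  have hcast (j : Fin (b + 1)) : ((b - (j : ℕ) : ℕ) : ℝ) = b - ((j : ℕ) : ℝ) :=
    Nat.cast_sub (Nat.lt_succ_iff.1 j.2)
  simp only [hcast]
  rw [integral_add .of_finite .of_finite, integral_mul_const, integral_mul_const,
    integral_sub .of_finite .of_finite]
  simp [mean]

theorem reach_succ_le (h n : ℕ) :
    reach μ (h + 1) n ≤ (b - mean μ) * reach μ h n + mean μ * reach μ h (n - 1) -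
      branchProb μ * reach μ h n ^ 2 := by
  set q := reach μ h n
  set p := reach μ h (n - 1)
  have hbound (j : Fin (b + 1)) : 1 - (1 - q) ^ (b - (j : ℕ)) * (1 - p) ^ (j : ℕ) ≤
      (b - (j : ℕ) : ℕ) * q + (j : ℕ) * p -
        Set.indicator {j : Fin (b + 1) | (j : ℕ) + 2 ≤ b} (fun _ => q ^ 2) j := by
    have hiff : 2 ≤ b - (j : ℕ) ↔ (j : ℕ) + 2 ≤ b := by omega
    simpa only [Set.indicator_apply, Set.mem_ofPred_eq, hiff] using
      one_sub_pow_mul_pow_le (reach_mem_Icc μ h (n - 1)) (reach_mem_Icc μ h n) (b - (j : ℕ)) j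
  refine (integral_mono (μ := μ) .of_finite .of_finite hbound).trans_eq ?_
  rw [integral_sub .of_finite .of_finite, integral_sub_mul_add_mul,
    integral_indicator_const _ .of_discrete]
  rfl

theorem le_one_add_mul_reach_succ (h n : ℕ) :
    (b - mean μ) * reach μ h n + mean μ * reach μ h (n - 1) ≤
      (1 + b * reach μ h n) * reach μ (h + 1) n := by
  have hbound := fun j : Fin (b + 1) => add_le_one_add_mul_one_sub_pow_mul_pow
    (reach_mem_Icc μ h (n - 1)).1 (reach_monotone μ h n.pred_le) (reach_mem_Icc μ h n).2
    (b - (j : ℕ)) j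
  have hcast (j : Fin (b + 1)) : ((b - (j : ℕ) : ℕ) : ℝ) + ((j : ℕ) : ℝ) = b := by
    exact_mod_cast Nat.sub_add_cancel (Nat.lt_succ_iff.1 j.2)
  simp only [hcast] at hbound
  have := integral_mono (μ := μ) .of_finite .of_finite hbound
  rwa [integral_sub_mul_add_mul, integral_const_mul] at this

end Reach

section Critical

variable {b : ℕ} {μ : Measure (Fin (b + 1))} [IsProbabilityMeasure μ]

theorem eq_dirac_of_ae_eq {α : Type*} [MeasurableSpace α] {ν : Measure α} [IsProbabilityMeasure ν]
    {a : α} (h : ∀ᵐ x ∂ν, x = a) : ν = Measure.dirac a :=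
  calc ν = ν.map id := Measure.map_id.symm
    _ = ν.map (fun _ => a) := Measure.map_congr h
    _ = Measure.dirac a := by rw [Measure.map_const, measure_univ, one_smul]

theorem branchProb_pos {k : Fin (b + 1)} (hmean : mean μ = b - 1) (hk : (k : ℕ) + 1 = b)
    (hμ : μ ≠ Measure.dirac k) : 0 < branchProb μ := by
  refine measureReal_nonneg.lt_of_ne' fun hzero => hμ (eq_dirac_of_ae_eq ?_)
  have hge : ∀ᵐ j : Fin (b + 1) ∂μ, (k : ℕ) ≤ (j : ℕ) := by
    have hnull : μ {j : Fin (b + 1) | (j : ℕ) + 2 ≤ b} = 0 := (measureReal_eq_zero_iff).1 hzero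
    filter_upwards [measure_eq_zero_iff_ae_notMem.1 hnull] with j hj
    omega
  have hnonneg : 0 ≤ᵐ[μ] fun j : Fin (b + 1) => ((j : ℕ) : ℝ) - (k : ℕ) := by
    filter_upwards [hge] with j hj
    exact sub_nonneg.2 (by exact_mod_cast hj)
  have hint : ∫ j : Fin (b + 1), (((j : ℕ) : ℝ) - (k : ℕ)) ∂μ = 0 := by
    have hk' : ((k : ℕ) : ℝ) = b - 1 := eq_sub_of_add_eq (by exact_mod_cast hk)
    rw [integral_sub .of_finite .of_finite, ← mean, hmean, integral_const, hk']
    simp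
  filter_upwards [(integral_eq_zero_iff_of_nonneg_ae hnonneg .of_finite).1 hint] with j hj
  exact Fin.ext (by exact_mod_cast sub_eq_zero.1 hj)

theorem one_le_one_add_mul_mul_reach_one (hmean : mean μ = b - 1) (h : ℕ) :
    1 ≤ (1 + b * h) * reach μ h 1 := by
  induction h with
  | zero => simp [reach]
  | succ h ih =>
    have hq := (reach_mem_Icc μ h 1).1
    have hstep := le_one_add_mul_reach_succ μ h 1
    rw [Nat.sub_self, reach_zero_right, mul_zero, add_zero, hmean, sub_sub_cancel, one_mul] at hstep
    set q := reach μ h 1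
    have hpos : 0 < 1 + b * q := by positivity
    refine le_of_mul_le_mul_left ?_ hpos
    calc (1 + b * q) * 1 ≤ (1 + b * h) * q + b * q := by linarith
      _ = (1 + b * (h + 1 : ℕ)) * q := by push_cast; ring
      _ ≤ (1 + b * (h + 1 : ℕ)) * ((1 + b * q) * reach μ (h + 1) 1) := by gcongr
      _ = (1 + b * q) * ((1 + b * (h + 1 : ℕ)) * reach μ (h + 1) 1) := by ring

theorem reach_le_two_mul_sq (hb : 2 ≤ b) (hmean : mean μ = b - 1) (h n : ℕ) :
    reach μ h n ≤ 2 * reach μ h (n + 1) ^ 2 := by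
  have hstep := le_one_add_mul_reach_succ μ h (n + 1)
  rw [Nat.add_sub_cancel, hmean, sub_sub_cancel, one_mul] at hstep
  have hq := (reach_mem_Icc μ h (n + 1)).1
  have hanti : reach μ (h + 1) (n + 1) ≤ reach μ h (n + 1) := reach_antitone μ (n + 1) h.le_succ
  have hb' : (2 : ℝ) ≤ b := by exact_mod_cast hb
  have hsq : (b - 1) * reach μ h n ≤ b * reach μ h (n + 1) ^ 2 := by
    nlinarith [mul_le_mul_of_nonneg_left hanti (by positivity : 0 ≤ 1 + b * reach μ h (n + 1))]
  refine le_of_mul_le_mul_left (hsq.trans ?_) (by linarith : (0 : ℝ) < b - 1)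
  nlinarith [sq_nonneg (reach μ h (n + 1))]

theorem two_mul_reach_one_le_pow (hb : 2 ≤ b) (hmean : mean μ = b - 1) (h n : ℕ) :
    2 * reach μ h 1 ≤ (2 * reach μ h (n + 1)) ^ 2 ^ n := by
  induction n with
  | zero => simp
  | succ n ih =>
    have hq := (reach_mem_Icc μ h (n + 1)).1
    calc 2 * reach μ h 1 ≤ (2 * reach μ h (n + 1)) ^ 2 ^ n := ih
      _ ≤ ((2 * reach μ h (n + 1 + 1)) ^ 2) ^ 2 ^ n := by
        gcongr
        linarith [reach_le_two_mul_sq hb hmean h (n + 1)]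
      _ = (2 * reach μ h (n + 1 + 1)) ^ 2 ^ (n + 1) := by rw [← pow_mul, pow_succ']

theorem inv_le_reach_three_pow (hb : 2 ≤ b) (hmean : mean μ = b - 1) (n : ℕ) :
    (6 * b : ℝ)⁻¹ ≤ reach μ (3 ^ 2 ^ n) (n + 1) := by
  have hb' : (2 : ℝ) ≤ b := by exact_mod_cast hb
  obtain ⟨h, hh⟩ : ∃ h, h = 3 ^ 2 ^ n := ⟨_, rfl⟩
  have hh_cast : (h : ℝ) = 3 ^ 2 ^ n := by exact_mod_cast hh
  rw [← hh]
  have hh_one : (1 : ℝ) ≤ h := hh_cast ▸ one_le_pow₀ (by norm_num)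
  have hq := (reach_mem_Icc μ h (n + 1)).1
  have hone : 1 ≤ (b * h) * (2 * reach μ h 1) := by
    have hbase := one_le_one_add_mul_mul_reach_one hmean h
    nlinarith [mul_nonneg (by nlinarith : 0 ≤ b * (h : ℝ) - 1) (reach_mem_Icc μ h 1).1]
  have hpow : 1 ≤ (3 * b * (2 * reach μ h (n + 1))) ^ 2 ^ n :=
    calc 1 ≤ (b * h) * (2 * reach μ h 1) := hone
      _ ≤ (b ^ 2 ^ n * h) * (2 * reach μ h (n + 1)) ^ 2 ^ n := by
        gcongr
        · exact mul_nonneg zero_le_two (reach_mem_Icc μ h 1).1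
        · exact le_self_pow₀ (by linarith) (by positivity)
        · exact two_mul_reach_one_le_pow hb hmean h n
      _ = (3 * b * (2 * reach μ h (n + 1))) ^ 2 ^ n := by
        rw [hh_cast, mul_pow (3 * b : ℝ), mul_pow 3 (b : ℝ), mul_comm (3 ^ _ : ℝ)]
  rw [inv_le_iff_one_le_mul₀ (by positivity)]
  linarith [(one_le_pow_iff_of_nonneg (by positivity) (by positivity)).1 hpow]

theorem reach_add_mul_sq_le (hmean : mean μ = b - 1) (hb : 1 ≤ b) (h k n : ℕ) :
    reach μ (h + k) (n + 1) + branchProb μ * k * reach μ (h + k) (n + 1) ^ 2 ≤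
      1 + (b - 1) * k * reach μ h n := by
  have hb' : (0 : ℝ) ≤ b - 1 := sub_nonneg.2 (by exact_mod_cast hb)
  have hc : 0 ≤ branchProb μ := measureReal_nonneg
  induction k with
  | zero => simpa using (reach_mem_Icc μ h (n + 1)).2
  | succ k ih =>
    have hstep := reach_succ_le μ (h + k) (n + 1)
    rw [Nat.add_sub_cancel, hmean, sub_sub_cancel, one_mul] at hstep
    have hanti : reach μ (h + k + 1) (n + 1) ≤ reach μ (h + k) (n + 1) :=
      reach_antitone μ (n + 1) (h + k).le_succ
    have hsq : reach μ (h + k + 1) (n + 1) ^ 2 ≤ reach μ (h + k) (n + 1) ^ 2 :=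
      pow_le_pow_left₀ (reach_mem_Icc μ _ _).1 hanti 2
    have hpred : (b - 1) * reach μ (h + k) n ≤ (b - 1) * reach μ h n :=
      mul_le_mul_of_nonneg_left (reach_antitone μ n (h.le_add_right k)) hb'
    have hcsq := mul_le_mul_of_nonneg_left hsq (by positivity : 0 ≤ branchProb μ * (k + 1))
    rw [← add_assoc]
    push_cast
    linarith

theorem reach_two_pow_mul_le (hmean : mean μ = b - 1) (hb : 1 ≤ b) (hc : 0 < branchProb μ)
    (n : ℕ) {N : ℕ} {x : ℝ} (hx : x ∈ Set.Icc (0 : ℝ) 1) (hN : 1 ≤ N * x ^ 2 ^ n) :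
    reach μ (2 ^ n * N) n ≤ b / branchProb μ * x := by
  set K := b / branchProb μ
  have hb' : (1 : ℝ) ≤ b := by exact_mod_cast hb
  have hKc : branchProb μ * K = b := mul_div_cancel₀ _ hc.ne'
  have hK_one : 1 ≤ K := (one_le_div hc).2 (measureReal_le_one.trans hb')
  induction n generalizing x with
  | zero => simpa [reach_zero_right] using mul_nonneg (by linarith) hx.1
  | succ n ih =>
    have hN' : 1 ≤ N * (x ^ 2) ^ 2 ^ n := by rwa [← pow_mul, ← pow_succ']
    have hx_sq : x ^ 2 ∈ Set.Icc (0 : ℝ) 1 := ⟨sq_nonneg x, pow_le_one₀ hx.1 hx.2⟩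
    have hstep := reach_add_mul_sq_le hmean hb (2 ^ n * N) (2 ^ n * N) n
    have hprev := ih hx_sq hN'
    rw [← two_mul, ← mul_assoc, ← pow_succ'] at hstep
    have hM_one : 1 ≤ ((2 ^ n * N : ℕ) : ℝ) * x ^ 2 :=
      calc (1 : ℝ) ≤ N * (x ^ 2) ^ 2 ^ n := hN'
        _ ≤ (2 ^ n * N : ℕ) * x ^ 2 := by
          gcongr
          · exact Nat.le_mul_of_pos_left N (by positivity)
          · exact pow_le_of_le_one hx_sq.1 hx_sq.2 (by positivity)
    set M : ℝ := ((2 ^ n * N : ℕ) : ℝ)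
    set q := reach μ (2 ^ (n + 1) * N) (n + 1)
    have hq : 0 ≤ q := (reach_mem_Icc μ _ _).1
    have hM : 0 < M := pos_of_mul_pos_left (zero_lt_one.trans_le hM_one) hx_sq.1
    refine le_of_sq_le_sq (le_of_mul_le_mul_left ?_ (mul_pos hc hM)) (mul_nonneg (by linarith) hx.1)
    calc branchProb μ * M * q ^ 2 ≤ 1 + (b - 1) * M * reach μ (2 ^ n * N) n := by linarith
      _ ≤ K * (M * x ^ 2) + (b - 1) * M * (K * x ^ 2) := by
        have hK_le := mul_le_mul hK_one hM_one zero_le_one (zero_le_one.trans hK_one)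
        have hM_le : (b - 1) * M * reach μ (2 ^ n * N) n ≤ (b - 1) * M * (K * x ^ 2) :=
          mul_le_mul_of_nonneg_left hprev (mul_nonneg (sub_nonneg.2 hb') hM.le)
        linarith
      _ = branchProb μ * K * M * K * x ^ 2 := by rw [hKc]; ring
      _ = branchProb μ * M * (K * x) ^ 2 := by ring

theorem tendsto_reach_two_pow_mul (hmean : mean μ = b - 1) (hb : 1 ≤ b) (hc : 0 < branchProb μ) :
    Tendsto (fun n => reach μ (2 ^ n * 2 ^ 4 ^ n) n) atTop (𝓝 0) := by
  have hbound (n : ℕ) :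
      reach μ (2 ^ n * 2 ^ 4 ^ n) n ≤ b / branchProb μ * (1 / 2 : ℝ) ^ 2 ^ n := by
    refine reach_two_pow_mul_le hmean hb hc n
      ⟨by positivity, pow_le_one₀ (by norm_num) (by norm_num)⟩ (le_of_eq ?_)
    rw [← pow_mul, ← mul_pow]
    norm_num [← mul_pow]
  refine squeeze_zero (fun n => (reach_mem_Icc μ _ _).1) hbound ?_
  have hpow : Tendsto (fun n : ℕ => (1 / 2 : ℝ) ^ 2 ^ n) atTop (𝓝 0) :=
    (tendsto_pow_atTop_nhds_zero_of_lt_one (by norm_num) (by norm_num)).comp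
      (tendsto_pow_atTop_atTop_of_one_lt one_lt_two)
  simpa using hpow.const_mul (b / branchProb μ)

theorem tendsto_one_sub_reach_three_pow (hb : 2 ≤ b) (hmean : mean μ = b - 1) :
    Tendsto (fun n => 1 - reach μ (3 ^ 2 ^ (n / 2)) n) atTop (𝓝 0) := by
  set u : ℝ := (6 * b : ℝ)⁻¹
  have hu : 0 < u := by positivity
  have hu_one : u ≤ 1 := (inv_le_reach_three_pow hb hmean 0).trans (reach_mem_Icc μ _ _).2
  have hbound : ∀ᶠ n in atTop,
      1 - reach μ (3 ^ 2 ^ (n / 2)) n ≤ (1 - u) ^ b ^ (n - n / 2 - 1) := by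
    filter_upwards [eventually_ge_atTop 1] with n hn
    set h := 3 ^ 2 ^ (n / 2)
    set j := n - n / 2 - 1
    have hsum : n / 2 + 1 + j = n := by omega
    calc 1 - reach μ h n ≤ 1 - reach μ (h + j) n :=
          sub_le_sub_left (reach_antitone μ n (h.le_add_right j)) 1
      _ = 1 - reach μ (h + j) (n / 2 + 1 + j) := by rw [hsum]
      _ ≤ (1 - reach μ h (n / 2 + 1)) ^ b ^ j := one_sub_reach_add_add_le_pow μ _ _ _
      _ ≤ (1 - u) ^ b ^ j := pow_le_pow_left₀ (one_sub_reach_nonneg μ _ _)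
          (sub_le_sub_left (inv_le_reach_three_pow hb hmean _) 1) _
  have hexp : Tendsto (fun n : ℕ => n - n / 2 - 1) atTop atTop :=
    tendsto_atTop_atTop.2 fun k => ⟨2 * k + 2, by omega⟩
  exact squeeze_zero' (Eventually.of_forall fun n => one_sub_reach_nonneg μ _ _) hbound
    ((tendsto_pow_atTop_nhds_zero_of_lt_one (sub_nonneg.2 hu_one) (sub_lt_self 1 hu)).comp
      ((tendsto_pow_atTop_atTop_of_one_lt hb).comp hexp))

theorem exp_exp_log_two_div_three_mul_le {n : ℕ} (hn : 2 ≤ n) :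
    Real.exp (Real.exp (Real.log 2 / 3 * n)) ≤ (3 ^ 2 ^ (n / 2) : ℕ) := by
  have hle : Real.log 2 / 3 * n ≤ (n / 2 : ℕ) * Real.log 2 := by
    have : (n : ℝ) ≤ 3 * (n / 2 : ℕ) := by exact_mod_cast (by omega : n ≤ 3 * (n / 2))
    nlinarith [Real.log_pos one_lt_two]
  calc Real.exp (Real.exp (Real.log 2 / 3 * n))
      ≤ Real.exp (Real.exp ((n / 2 : ℕ) * Real.log 2)) := by gcongr
    _ = Real.exp 1 ^ 2 ^ (n / 2) := by
      rw [Real.exp_nat_mul, Real.exp_log two_pos, ← Real.exp_nat_mul, mul_one]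
      norm_cast
    _ ≤ 3 ^ 2 ^ (n / 2) := by gcongr; exact Real.exp_one_lt_three.le
    _ = (3 ^ 2 ^ (n / 2) : ℕ) := by norm_cast

theorem two_pow_mul_two_pow_lt_exp_exp (n : ℕ) :
    ((2 ^ n * 2 ^ 4 ^ n : ℕ) : ℝ) < Real.exp (Real.exp (3 * n)) := by
  have hexponent : n + 4 ^ n ≤ 8 ^ n := by
    induction n with
    | zero => norm_num
    | succ n ih =>
      have := Nat.one_le_pow n 4 (by norm_num)
      omega
  have height : (8 : ℝ) ^ n ≤ Real.exp (3 * n) :=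
    calc (8 : ℝ) ^ n = 2 ^ (3 * n) := by rw [pow_mul]; norm_num
      _ ≤ Real.exp 1 ^ (3 * n) := by gcongr; exact Real.exp_one_gt_two.le
      _ = Real.exp (3 * n) := by rw [← Real.exp_nat_mul, mul_one]; norm_cast
  calc ((2 ^ n * 2 ^ 4 ^ n : ℕ) : ℝ) = 2 ^ (n + 4 ^ n) := by rw [pow_add]; norm_cast
    _ ≤ 2 ^ 8 ^ n := by gcongr; norm_num
    _ < Real.exp 1 ^ 8 ^ n := by gcongr; exact Real.exp_one_gt_two
    _ = Real.exp (8 ^ n) := by rw [← Real.exp_nat_mul, mul_one]; norm_cast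
    _ ≤ Real.exp (Real.exp (3 * n)) := by gcongr

end Critical

section Supercritical

variable {b : ℕ} {μ : Measure (Fin (b + 1))} [IsProbabilityMeasure μ]

variable (μ) in
theorem mean_mem_Icc : mean μ ∈ Set.Icc (0 : ℝ) b := by
  refine ⟨integral_nonneg fun j => Nat.cast_nonneg _, ?_⟩
  have hle (j : Fin (b + 1)) : ((j : ℕ) : ℝ) ≤ b := by exact_mod_cast Nat.lt_succ_iff.1 j.2
  simpa [mean] using integral_mono (μ := μ) .of_finite .of_finite hle

theorem reach_le_pow_mul_pow {x y : ℝ} (hx : 1 ≤ x) (hy : b - mean μ + mean μ / x ≤ y) (h n : ℕ) :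
    reach μ h n ≤ y ^ h * x ^ n := by
  have hmean := mean_mem_Icc μ
  have hx_pos : 0 < x := zero_lt_one.trans_le hx
  have hy_nonneg : 0 ≤ y :=
    (add_nonneg (sub_nonneg.2 hmean.2) (div_nonneg hmean.1 hx_pos.le)).trans hy
  induction h generalizing n with
  | zero => simpa using (reach_mem_Icc μ 0 n).2.trans (one_le_pow₀ hx)
  | succ h ih =>
    cases n with
    | zero => rw [reach_zero_right]; positivity
    | succ n =>
      have hstep := reach_succ_le μ h (n + 1)
      have hsq : 0 ≤ branchProb μ * reach μ h (n + 1) ^ 2 :=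
        mul_nonneg measureReal_nonneg (sq_nonneg _)
      have hfirst := mul_le_mul_of_nonneg_left (ih (n + 1)) (sub_nonneg.2 hmean.2)
      have hsecond := mul_le_mul_of_nonneg_left (ih n) hmean.1
      rw [Nat.add_sub_cancel] at hstep
      calc reach μ (h + 1) (n + 1)
          ≤ (b - mean μ) * (y ^ h * x ^ (n + 1)) + mean μ * (y ^ h * x ^ n) := by linarith
        _ = (b - mean μ + mean μ / x) * (y ^ h * x ^ (n + 1)) := by field_simp; ring
        _ ≤ y * (y ^ h * x ^ (n + 1)) := by gcongr
        _ = y ^ (h + 1) * x ^ (n + 1) := by ring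

theorem exists_tendsto_reach_mul (hb : 0 < b) (hmean : b - 1 < mean μ) :
    ∃ L : ℕ, Tendsto (fun n => reach μ (L * n) n) atTop (𝓝 0) := by
  have hb' : (1 : ℝ) ≤ b := by exact_mod_cast hb
  have hmean_le := (mean_mem_Icc μ).2
  have hgap : 0 < 1 - (b - mean μ) := by linarith
  set x := 2 * b / (1 - (b - mean μ)) with hx
  set y := (1 + (b - mean μ)) / 2 with hy
  have hx_one : 1 ≤ x := (one_le_div hgap).2 (by linarith)
  have hxy : b - mean μ + mean μ / x ≤ y :=
    calc b - mean μ + mean μ / x ≤ b - mean μ + b / x := by gcongr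
      _ = y := by rw [hx, hy]; field_simp; ring
  obtain ⟨L, hL⟩ := exists_pow_lt_of_lt_one (by positivity : 0 < 1 / (2 * x))
    (by linarith : y < 1)
  have hbound (n : ℕ) : reach μ (L * n) n ≤ (1 / 2 : ℝ) ^ n :=
    calc reach μ (L * n) n ≤ y ^ (L * n) * x ^ n := reach_le_pow_mul_pow hx_one hxy _ _
      _ = (y ^ L * x) ^ n := by rw [pow_mul, mul_pow]
      _ ≤ (1 / 2) ^ n := by
        rw [lt_div_iff₀ (by positivity)] at hL
        refine pow_le_pow_left₀ (mul_nonneg (pow_nonneg ?_ L) ?_) ?_ n <;> linarith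
  exact ⟨L, squeeze_zero (fun n => (reach_mem_Icc μ _ _).1) hbound
    (tendsto_pow_atTop_nhds_zero_of_lt_one (by norm_num) (by norm_num))⟩

variable (μ) in
theorem reach_self_succ (hb : b ≠ 0) (n : ℕ) : reach μ n (n + 1) = 1 := by
  have hle := one_sub_reach_add_add_le_pow μ 0 1 n
  rw [zero_add, add_comm 1, show reach μ 0 1 = 1 by simp [reach], sub_self,
    zero_pow (pow_ne_zero n hb)] at hle
  exact (reach_mem_Icc μ n (n + 1)).2.antisymm (sub_nonpos.1 hle)

end Supercritical

section MaxDepth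

variable {b : ℕ} {μ : Measure (Fin (b + 1))} [IsProbabilityMeasure μ] {Ω : Type*}
  [MeasurableSpace Ω] {P : Measure Ω} [IsProbabilityMeasure P] {R : List (Fin b) → Ω → Fin (b + 1)}

theorem tendsto_measure_maxDepth (hR : ∀ v, Measurable (R v)) (hind : iIndepFun R P)
    (hμ : ∀ v, P.map (R v) = μ) {L H : ℕ → ℕ}
    (hL : Tendsto (fun n => 1 - reach μ (L n) n) atTop (𝓝 0))
    (hH : Tendsto (fun n => reach μ (H n) n) atTop (𝓝 0)) {p : ℕ → ℕ → Prop}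
    (hp : ∀ᶠ n in atTop, ∀ d, L n < d → d ≤ H n → p n d) :
    Tendsto (fun n => P {ω | ∃ d : ℕ, maxDepth (fun v => R v ω) n = d ∧ p n d}) atTop (𝓝 1) := by
  set A : ℕ → Set Ω := fun n => {ω | ∃ d : ℕ, maxDepth (fun v => R v ω) n = d ∧ p n d}
  have hle : ∀ᶠ n in atTop, 1 - reach μ (H n) n - (1 - reach μ (L n) n) ≤ P.real (A n) := by
    filter_upwards [hp] with n hn
    rw [← measureReal_unreached hR hind hμ (H n) n [],
      ← measureReal_unreached hR hind hμ (L n) n [], sub_le_iff_le_add]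
    refine (measureReal_mono fun ω hω => ?_).trans (measureReal_union_le _ _)
    by_cases hlow : Unreached (fun w => R w ω) (L n) n []
    · exact Or.inr hlow
    · obtain ⟨d, hd, hlt, hle⟩ := exists_maxDepth_eq hlow hω
      exact Or.inl ⟨d, hd, hn d hlt hle⟩
  have hlim : Tendsto (fun n => P.real (A n)) atTop (𝓝 1) := by
    refine tendsto_of_tendsto_of_tendsto_of_le_of_le' ?_ tendsto_const_nhds hle
      (Eventually.of_forall fun n => measureReal_le_one)
    simpa using (hH.const_sub 1).sub hL
  simpa [ofReal_measureReal] using ENNReal.tendsto_ofReal hlim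

theorem tendsto_measure_exp_exp_lt_maxDepth_lt (hb : 2 ≤ b) (hmean : mean μ = b - 1)
    (hc : 0 < branchProb μ) (hR : ∀ v, Measurable (R v)) (hind : iIndepFun R P)
    (hμ : ∀ v, P.map (R v) = μ) :
    Tendsto (fun n : ℕ => P {ω | ∃ d : ℕ, maxDepth (fun v => R v ω) n = d ∧
      Real.exp (Real.exp (Real.log 2 / 3 * n)) < d ∧ (d : ℝ) < Real.exp (Real.exp (3 * n))})
      atTop (𝓝 1) := by
  refine tendsto_measure_maxDepth hR hind hμ (tendsto_one_sub_reach_three_pow hb hmean)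
    (tendsto_reach_two_pow_mul hmean (by omega) hc) ?_
  filter_upwards [eventually_ge_atTop 2] with n hn d hlow hhigh
  exact ⟨(exp_exp_log_two_div_three_mul_le hn).trans_lt (Nat.cast_lt.2 hlow),
    (Nat.cast_le.2 hhigh).trans_lt (two_pow_mul_two_pow_lt_exp_exp n)⟩

theorem tendsto_measure_le_maxDepth_lt (hb : b ≠ 0) {L : ℕ}
    (hL : Tendsto (fun n => reach μ (L * n) n) atTop (𝓝 0)) (hR : ∀ v, Measurable (R v))
    (hind : iIndepFun R P) (hμ : ∀ v, P.map (R v) = μ) :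
    Tendsto (fun n : ℕ => P {ω | ∃ d : ℕ, maxDepth (fun v => R v ω) n = d ∧
      n ≤ d ∧ (d : ℝ) < (L + 1 : ℝ) * n}) atTop (𝓝 1) := by
  have hlow : Tendsto (fun n => 1 - reach μ (n - 1) n) atTop (𝓝 0) := by
    refine tendsto_const_nhds.congr' ?_
    filter_upwards [eventually_ge_atTop 1] with n hn
    obtain ⟨n, rfl⟩ := Nat.exists_eq_add_of_le' hn
    rw [Nat.add_sub_cancel, reach_self_succ μ hb, sub_self]
  refine tendsto_measure_maxDepth hR hind hμ hlow hL ?_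
  filter_upwards [eventually_ge_atTop 1] with n hn d hlt hle
  refine ⟨by omega, ?_⟩
  exact_mod_cast hle.trans_lt (Nat.mul_lt_mul_of_pos_right L.lt_succ_self hn)

end MaxDepth

end RotorWalk

theorem theorem7 (b : ℕ) (hb : 2 ≤ b)
    (μ : Measure (Fin (b + 1))) [IsProbabilityMeasure μ]
    (hμ : ∀ k : Fin (b + 1), μ ≠ Measure.dirac k) :
    ∃ c C : ℝ, 0 < c ∧ 0 < C ∧
      ∀ (Ω : Type*) [MeasurableSpace Ω] (P : Measure Ω) [IsProbabilityMeasure P]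
        (R : List (Fin b) → Ω → Fin (b + 1)),
        (∀ v, Measurable (R v)) → iIndepFun R P → (∀ v, P.map (R v) = μ) →
        ((∫ k, ((k : ℕ) : ℝ) ∂μ = (b : ℝ) - 1 →
            Tendsto (fun n : ℕ => P {ω | ∃ d : ℕ,
                RotorWalk.maxDepth (fun v => R v ω) n = (d : ℕ∞) ∧
                Real.exp (Real.exp (c * n)) < d ∧ (d : ℝ) < Real.exp (Real.exp (C * n))})
              atTop (𝓝 1)) ∧
          ((b : ℝ) - 1 < ∫ k, ((k : ℕ) : ℝ) ∂μ →
            Tendsto (fun n : ℕ => P {ω | ∃ d : ℕ,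
                RotorWalk.maxDepth (fun v => R v ω) n = (d : ℕ∞) ∧
                n ≤ d ∧ (d : ℝ) < C * n})
              atTop (𝓝 1))) := by
  rcases lt_or_ge ((b : ℝ) - 1) (RotorWalk.mean μ) with hsuper | hle
  · obtain ⟨L, hL⟩ := RotorWalk.exists_tendsto_reach_mul (by omega) hsuper
    refine ⟨1, L + 1, one_pos, by positivity, fun Ω _ P _ R hR hind hlaw => ⟨?_, fun _ => ?_⟩⟩
    · exact fun hmean => absurd hmean hsuper.ne'
    · exact RotorWalk.tendsto_measure_le_maxDepth_lt (by omega) hL hR hind hlaw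
  · refine ⟨Real.log 2 / 3, 3, by positivity, by positivity,
      fun Ω _ P _ R hR hind hlaw => ⟨fun hmean => ?_, fun hsuper => ?_⟩⟩
    · have hc := RotorWalk.branchProb_pos (k := ⟨b - 1, by omega⟩) hmean
        (Nat.sub_add_cancel (by omega)) (hμ _)
      exact RotorWalk.tendsto_measure_exp_exp_lt_maxDepth_lt hb hmean hc hR hind hlaw
    · exact absurd hsuper hle.not_gt
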